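/- Call $z\in\mathbb{C}\setminus\{0\}$ a zero of order $k$ of a Laurent polynomial $P\in\mathbb{Z}[t,t^{-1}]$ if $(t-z)^k$, but not $(t-z)^{k+1}$, divides $P$ in $\mathbb{C}[t,t^{-1}]$. (1) Let $P(t)=a_0+a_1(t+t^{-1})+\cdots+a_d(t^d+t^{-d})\in\mathbb{Z}[t,t^{-1}]$ be a palindromic integral Laurent polynomial with $a_0$ odd. If $$|a_j|\ \ge\ |a_0|\cdot\cos\left(\frac{\pi}{\lfloor d/j\rfloor+2}\right)$$ holds for some $j\in\{1,\ldots,d\}$, then $P$ has a zero of odd order on the complex unit circle. (2) Let $K\subset S^3$ be a tame knot, and let $\Delta_K(t)=a_0+a_1(t+t^{-1})+\cdots+a_d(t^d+t^{-d})\in\mathbb{Z}[t,t^{-1}]$ be its Alexander polynomial in the Conway normalization, that is, the generator of the order ideal of the $\mathbb{Z}[t,t^{-1}]$-module $G'/G''$, where $G=\pi_1(S^3\setminus K)$ and $t$ acts by conjugation by an element of $G$ that generates $G/G'\cong\mathbb{Z}$, which satisfies $\Delta_K(t)=\Delta_K(t^{-1})$ and $\Delta_K(1)=1$. If the displayed inequality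 holds for some $j\in\{1,\ldots,d\}$, then $\Delta_K$ has a zero of odd order on the complex unit circle. In both parts $a_d=0$ is allowed. -/

import Mathlib

open scoped LaurentPolynomial

noncomputable section

/-! ## Palindromic Laurent polynomials and zeros on the unit circle -/

/-- The palindromic integral Laurent polynomial
`a 0 + a 1 * (t + t⁻¹) + ⋯ + a d * (t ^ d + t ^ (-d))`; only `a 0, …, a d` matter. -/
def palindromicLaurent (d : ℕ) (a : ℕ → ℤ) : ℤ[T;T⁻¹] :=
  LaurentPolynomial.C (a 0) +
    ∑ i ∈ Finset.Icc 1 d,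
      LaurentPolynomial.C (a i) *
        (LaurentPolynomial.T (i : ℤ) + LaurentPolynomial.T (-(i : ℤ)))

/-- `P` has a zero of order exactly `k` at the (nonzero) complex number `z`: the factor `t - z`
divides `P` exactly `k` times in `ℂ[t, t⁻¹]`. For `k = 0` this says `P z ≠ 0`, and for `P = 0` it
holds for no `k`. -/
def HasZeroOfOrder (P : ℤ[T;T⁻¹]) (z : ℂ) (k : ℕ) : Prop :=
  emultiplicity (LaurentPolynomial.T 1 - LaurentPolynomial.C z : ℂ[T;T⁻¹])
    (AddMonoidAlgebra.mapRingHom ℤ (Int.castRingHom ℂ) P) = k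

/-- `P` has a zero of odd order on the complex unit circle. -/
def HasOddOrderZeroOnUnitCircle (P : ℤ[T;T⁻¹]) : Prop :=
  ∃ z : ℂ, ‖z‖ = 1 ∧ ∃ k : ℕ, Odd k ∧ HasZeroOfOrder P z k

/-- The inequality `|a j| ≥ |a 0| * cos (π / (⌊d / j⌋ + 2))`. -/
def CosineBound (d : ℕ) (a : ℕ → ℤ) (j : ℕ) : Prop :=
  |(a j : ℝ)| ≥ |(a 0 : ℝ)| * Real.cos (Real.pi / ((⌊(d : ℝ) / (j : ℝ)⌋ : ℝ) + 2))

/-! ## Knots in the three-sphere -/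

/-- The standard three-sphere. -/
abbrev ThreeSphere : Type :=
  Metric.sphere (0 : EuclideanSpace ℝ (Fin 4)) 1

/-- `K` is a tame knot: a subset of `S³` that is homeomorphic to the circle and is locally flat,
i.e. near each of its points the pair `(S³, K)` looks like `(ℝ³, ℝ × {0})`. -/
structure IsTameKnot (K : Set ThreeSphere) : Prop where
  circle : Nonempty (K ≃ₜ Circle)
  locallyFlat : ∀ x ∈ K, ∃ e : OpenPartialHomeomorph ThreeSphere (EuclideanSpace ℝ (Fin 3)),
    x ∈ e.source ∧ e.target = Set.univ ∧
      ∀ y ∈ e.source, y ∈ K ↔ e y 1 = 0 ∧ e y 2 = 0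

/-! ## The Alexander polynomial -/

/-- The action of `g` by conjugation on the abelianization `G' / G''` of the commutator
subgroup `G'` of `G`. -/
def conjOnAlexander {G : Type*} [Group G] (g : G) :
    Abelianization (commutator G) ≃* Abelianization (commutator G) :=
  (MulAut.conjNormal g : MulAut (commutator G)).abelianizationCongr

/-- The matrix `M` over `ℤ[t, t⁻¹]` (rows: relations, columns: generators) presents `G' / G''`,
regarded as a `ℤ[t, t⁻¹]`-module in which `t` acts by conjugation by `g`.
Additivity and compatibility with `t` are the same as `ℤ[t, t⁻¹]`-linearity, as `t` acts
invertibly. -/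
def PresentsAlexanderModule {G : Type*} [Group G] (g : G) {m n : ℕ}
    (M : Matrix (Fin m) (Fin n) ℤ[T;T⁻¹]) : Prop :=
  ∃ p : (Fin n → ℤ[T;T⁻¹]) →+ Additive (Abelianization (commutator G)),
    Function.Surjective p ∧
    (∀ v, p ((LaurentPolynomial.T 1 : ℤ[T;T⁻¹]) • v) =
      Additive.ofMul (conjOnAlexander g (p v).toMul)) ∧
    ∀ v, p v = 0 ↔ v ∈ Submodule.span ℤ[T;T⁻¹] (Set.range M.row)

/-- The ideal generated by the maximal (`n × n`) minors of a presentation matrix with `n`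
generators. -/
def maximalMinorsIdeal {R : Type*} [CommRing R] {m n : ℕ} (M : Matrix (Fin m) (Fin n) R) :
    Ideal R :=
  Ideal.span (Set.range fun r : Fin n → Fin m => (M.submatrix r id).det)

/-- `D` is an Alexander polynomial of the group `G`, whose abelianization has to be infinite
cyclic: a generator of the order ideal (the ideal of maximal minors of a presentation matrix) of
the Alexander module `G' / G''`, where `t` acts as an element `g` of `G` that maps to a generator
of the abelianization. -/
def IsGroupAlexanderPolynomial (G : Type*) [Group G] (D : ℤ[T;T⁻¹]) : Prop :=
  ∃ (φ : G →* Multiplicative ℤ) (g : G),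
    φ.ker = commutator G ∧ φ g = Multiplicative.ofAdd 1 ∧
    ∃ (m n : ℕ) (M : Matrix (Fin m) (Fin n) ℤ[T;T⁻¹]),
      PresentsAlexanderModule g M ∧ maximalMinorsIdeal M = Ideal.span {D}

/-- The Conway normalization: `D(t) = D(t⁻¹)` and `D(1) = 1`. -/
def IsConwayNormalized (D : ℤ[T;T⁻¹]) : Prop :=
  LaurentPolynomial.invert D = D ∧ LaurentPolynomial.eval₂ (RingHom.id ℤ) 1 D = 1

/-- `D` is the Conway-normalized Alexander polynomial of `K ⊆ S³`: the Conway-normalized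
representative of the Alexander polynomial of the group `π₁(S³ \ K)`. (For a knot `K` the complement
is path connected, so that the base point is immaterial.) -/
def IsConwayAlexanderPolynomial (K : Set ThreeSphere) (D : ℤ[T;T⁻¹]) : Prop :=
  (∃ x : (Kᶜ : Set ThreeSphere), IsGroupAlexanderPolynomial (FundamentalGroup _ x) D) ∧
    IsConwayNormalized D

end

/-! On the unit circle `P` restricts to a real cosine polynomial `f`. If every zero there has even
order, `f` never changes sign (`nonneg_or_nonpos_of_even_rootMultiplicity`), so `f ≥ 0` after
replacing `a` by `-a` if necessary. The Egerváry–Szász inequality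
(`abs_coeff_le_of_cosinePolynomial_nonneg`) then gives `|a j| ≤ |a 0| cos (π / N)` with `N = ⌊d / j⌋
+ 2`, and the assumed bound forces equality. So `cos (π / N)` is rational; by Niven's theorem it is
`1 / 2`, which contradicts `a 0` odd (`abs_ne_abs_mul_cos_pi_div`).

Egerváry–Szász is proved by quadrature: averages over `j * N > d + j` equispaced nodes recover `a 0`
from `f` and `a j` from `f · cos (j θ)`. The nodes are placed so that `j θ` runs over odd multiples
of `π / N`, where the cosine is at most `cos (π / N)`.

For knots, `Δ(1) = 1` makes `a 0` odd. -/

/-! ### Orders of zeros: Laurent polynomials versus polynomials -/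

open Polynomial in
/-- The `X - z` multiplicity of a polynomial, at `z ≠ 0`, is unchanged in Laurent polynomials. -/
theorem X_sub_C_pow_dvd_iff_laurent {K : Type*} [Field K] (p : K[X]) {z : K} (hz : z ≠ 0) (k : ℕ) :
    (LaurentPolynomial.T 1 - LaurentPolynomial.C z : K[T;T⁻¹]) ^ k ∣ toLaurent p ↔
      (X - C z) ^ k ∣ p := by
  have hX : toLaurent ((X - C z) ^ k) =
      (LaurentPolynomial.T 1 - LaurentPolynomial.C z : K[T;T⁻¹]) ^ k := by
    simp
  rw [← hX]
  refine ⟨?_, fun h => map_dvd _ h⟩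
  rintro ⟨Q, hQ⟩
  obtain ⟨n, q, hq⟩ := LaurentPolynomial.exists_T_pow Q
  have h : (X - C z) ^ k ∣ p * X ^ n := by
    refine ⟨q, toLaurent_injective ?_⟩
    rw [map_mul, map_mul, hq, hQ, toLaurent_X_pow, mul_assoc]
  -- `X ^ n` can be cancelled, as `X - z` is coprime to `X` for `z ≠ 0`.
  refine IsCoprime.dvd_of_dvd_mul_right (IsCoprime.pow ?_) h
  have := isCoprime_X_sub_C_of_isUnit_sub (a := z) (b := 0) (by simpa using hz)
  simpa using this

open Polynomial in
theorem hasZeroOfOrder_rootMultiplicity {P : ℤ[T;T⁻¹]} {p : ℂ[X]} {n : ℕ} (hp0 : p ≠ 0)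
    (hp : toLaurent p =
      AddMonoidAlgebra.mapRingHom ℤ (Int.castRingHom ℂ) P * LaurentPolynomial.T n)
    {z : ℂ} (hz : z ≠ 0) : HasZeroOfOrder P z (p.rootMultiplicity z) := by
  have key (k : ℕ) : (LaurentPolynomial.T 1 - LaurentPolynomial.C z : ℂ[T;T⁻¹]) ^ k ∣
      AddMonoidAlgebra.mapRingHom ℤ (Int.castRingHom ℂ) P ↔ k ≤ p.rootMultiplicity z := by
    rw [le_rootMultiplicity_iff hp0, ← X_sub_C_pow_dvd_iff_laurent p hz, hp,
      (LaurentPolynomial.isUnit_T _).dvd_mul_right]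
  unfold HasZeroOfOrder
  rw [emultiplicity_eq_coe, key, key]
  exact ⟨le_rfl, by omega⟩

/-! ### Even orders imply constant sign on the circle -/

/-- A continuous real function that vanishes nowhere has constant sign. -/
theorem nonneg_or_nonpos_of_continuous_ne_zero {f : ℝ → ℝ} (hf : Continuous f)
    (h0 : ∀ x, f x ≠ 0) : (∀ x, 0 ≤ f x) ∨ ∀ x, f x ≤ 0 := by
  by_contra! h
  obtain ⟨⟨x, hx⟩, y, hy⟩ := h
  obtain ⟨c, hc⟩ := mem_range_of_exists_le_of_exists_ge hf ⟨x, hx.le⟩ ⟨y, hy.le⟩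
  exact h0 c hc

theorem dense_setOf_exp_mul_I_ne (z : ℂ) : Dense {θ : ℝ | Complex.exp (θ * Complex.I) ≠ z} := by
  by_cases hz : ∃ α : ℝ, Complex.exp (α * Complex.I) = z
  · obtain ⟨α, rfl⟩ := hz
    have hc : (Set.range fun n : ℤ => α + n * (2 * Real.pi)).Countable := Set.countable_range _
    refine (hc.dense_compl ℝ).mono ?_
    intro θ hθ h
    obtain ⟨n, hn⟩ := Complex.exp_eq_exp_iff_exists_int.1 h
    refine hθ ⟨n, ?_⟩
    have h2 : (θ : ℂ) * Complex.I = (α + n * (2 * Real.pi)) * Complex.I := by rw [hn]; ring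
    have h3 := mul_right_cancel₀ Complex.I_ne_zero h2
    exact_mod_cast h3.symm
  · push Not at hz
    convert! dense_univ
    exact Set.eq_univ_of_forall hz

/-- Conjugation is inversion on the unit circle. Hence a double root there contributes a nonnegative
factor times a monomial in `w`. -/
theorem sub_sq_eq_of_norm_eq_one {w z : ℂ} (hw : ‖w‖ = 1) (hz : ‖z‖ = 1) :
    (w - z) ^ 2 = (Complex.normSq (w - z) : ℂ) * (-(z * w)) := by
  have hw' : w * (starRingEnd ℂ) w = 1 := by
    rw [Complex.mul_conj, Complex.normSq_eq_norm_sq, hw]; simp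
  have hz' : z * (starRingEnd ℂ) z = 1 := by
    rw [Complex.mul_conj, Complex.normSq_eq_norm_sq, hz]; simp
  rw [← Complex.mul_conj, map_sub]
  linear_combination (w - z) * z * hw' - (w - z) * w * hz'

open Polynomial in
/-- If all roots of `p` on the unit circle have even multiplicity and `c w ^ n p(w)` is real for
all `w` on the unit circle, then it has constant sign there. -/
theorem nonneg_or_nonpos_of_even_rootMultiplicity (p : ℂ[X])
    (hp : ∀ z : ℂ, ‖z‖ = 1 → Even (p.rootMultiplicity z)) (n : ℤ) (c : ℂ) (f : ℝ → ℝ)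
    (hf : ∀ θ : ℝ, (f θ : ℂ) = c * Complex.exp (θ * Complex.I) ^ n *
      p.eval (Complex.exp (θ * Complex.I))) :
    (∀ θ, 0 ≤ f θ) ∨ ∀ θ, f θ ≤ 0 := by
  induction hN : p.natDegree using Nat.strong_induction_on generalizing p n c f with
  | _ N ih =>
  subst hN
  by_cases hp0 : p = 0
  · left; intro θ
    have := hf θ
    simp [hp0] at this
    simp [this]
  by_cases hc : c = 0
  · left; intro θ
    have := hf θ
    simp [hc] at this
    simp [this]
  have hcont (q : ℂ[X]) (m : ℤ) (b : ℂ) : Continuous fun θ : ℝ =>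
      b * Complex.exp (θ * Complex.I) ^ m * q.eval (Complex.exp (θ * Complex.I)) := by
    have h1 : Continuous fun θ : ℝ => Complex.exp (θ * Complex.I) := by fun_prop
    exact (continuous_const.mul (h1.zpow₀ m fun θ => Or.inl (Complex.exp_ne_zero _))).mul
      (q.continuous.comp h1)
  by_cases hroot : ∃ z : ℂ, ‖z‖ = 1 ∧ p.IsRoot z
  · obtain ⟨z, hz, hzp⟩ := hroot
    have hpos : 0 < p.rootMultiplicity z := (rootMultiplicity_pos hp0).2 hzp
    have h2 : 2 ≤ p.rootMultiplicity z := by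
      obtain ⟨r, hr⟩ := hp z hz
      omega
    obtain ⟨q, hq⟩ := (le_rootMultiplicity_iff hp0).1 h2
    have hq0 : q ≠ 0 := by rintro rfl; simp at hq; exact hp0 hq
    have hdeg : q.natDegree < p.natDegree := by
      rw [hq, natDegree_mul (pow_ne_zero _ (X_sub_C_ne_zero z)) hq0, natDegree_pow,
        natDegree_X_sub_C]
      omega
    have hqe (w : ℂ) (hw : ‖w‖ = 1) : Even (q.rootMultiplicity w) := by
      have h := hp w hw
      have hs : (X - C z) ^ 2 ≠ 0 := pow_ne_zero _ (X_sub_C_ne_zero z)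
      rw [hq, rootMultiplicity_mul (mul_ne_zero hs hq0), Nat.even_add] at h
      rw [sq] at h hs
      rw [rootMultiplicity_mul hs] at h
      exact h.1 (Even.add_self _)
    -- Splitting off `(X - z) ^ 2` leaves the monomial `-(z * w)`, absorbed into `c` and `n`.
    set H : ℝ → ℂ := fun θ => -(c * z) * Complex.exp (θ * Complex.I) ^ (n + 1) *
      q.eval (Complex.exp (θ * Complex.I)) with hH
    have hfH (θ : ℝ) :
        (f θ : ℂ) = (Complex.normSq (Complex.exp (θ * Complex.I) - z) : ℂ) * H θ := by
      rw [hf, hq, hH]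
      simp only [eval_mul, eval_pow, eval_sub, eval_X, eval_C]
      rw [sub_sq_eq_of_norm_eq_one (Complex.norm_exp_ofReal_mul_I θ) hz,
        zpow_add_one₀ (Complex.exp_ne_zero _)]
      ring
    -- Away from `z` one can divide by the positive real factor; at `z` reality follows by
    -- continuity and density.
    have him (θ : ℝ) : (H θ).im = 0 := by
      have hcl : IsClosed {θ : ℝ | (H θ).im = 0} :=
        isClosed_eq (Complex.continuous_im.comp (hcont q (n + 1) (-(c * z)))) continuous_const
      have hsub : {θ : ℝ | Complex.exp (θ * Complex.I) ≠ z} ⊆ {θ : ℝ | (H θ).im = 0} := by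
        intro θ hθ
        have h := congrArg Complex.im (hfH θ)
        rw [Complex.ofReal_im, Complex.im_ofReal_mul] at h
        refine (mul_eq_zero.1 h.symm).resolve_left ?_
        rw [Complex.normSq_eq_zero.not, sub_eq_zero]
        exact hθ
      exact hcl.closure_subset_iff.2 hsub (dense_setOf_exp_mul_I_ne z θ)
    have hre (θ : ℝ) : ((H θ).re : ℂ) = H θ := Complex.ext (by simp) (by simp [him])
    have hfre (θ : ℝ) : f θ = Complex.normSq (Complex.exp (θ * Complex.I) - z) * (H θ).re := by
      have h := hfH θ
      rw [← hre] at h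
      exact_mod_cast h
    rcases ih _ hdeg q hqe (n + 1) (-(c * z)) (fun θ => (H θ).re) hre rfl with h | h
    · exact Or.inl fun θ => by
        rw [hfre]; exact mul_nonneg (Complex.normSq_nonneg _) (h θ)
    · exact Or.inr fun θ => by
        rw [hfre]; exact mul_nonpos_of_nonneg_of_nonpos (Complex.normSq_nonneg _) (h θ)
  · push Not at hroot
    refine nonneg_or_nonpos_of_continuous_ne_zero ?_ fun θ h => ?_
    · have h := Complex.continuous_re.comp (hcont p n c)
      refine h.congr fun θ => ?_
      simp only [Function.comp]
      rw [← hf, Complex.ofReal_re]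
    · have h1 := hf θ
      rw [h, Complex.ofReal_zero] at h1
      refine mul_ne_zero (mul_ne_zero hc (zpow_ne_zero _ (Complex.exp_ne_zero _))) ?_ h1.symm
      exact hroot _ (Complex.norm_exp_ofReal_mul_I θ)

/-! ### The restriction to the circle as a cosine polynomial -/

/-- The cosine polynomial `a 0 + ∑ 2 a i cos (i θ)`. -/
noncomputable def cosinePolynomial (d : ℕ) (a : ℕ → ℤ) (θ : ℝ) : ℝ :=
  a 0 + ∑ i ∈ Finset.Icc 1 d, a i * (2 * Real.cos (i * θ))

theorem eval₂_mapRingHom_palindromicLaurent (d : ℕ) (a : ℕ → ℤ) (u : ℂˣ) (θ : ℝ)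
    (hu : (u : ℂ) = Complex.exp (θ * Complex.I)) :
    LaurentPolynomial.eval₂ (RingHom.id ℂ) u
      (AddMonoidAlgebra.mapRingHom ℤ (Int.castRingHom ℂ) (palindromicLaurent d a)) =
      cosinePolynomial d a θ := by
  have hC (n : ℤ) : AddMonoidAlgebra.mapRingHom ℤ (Int.castRingHom ℂ) (LaurentPolynomial.C n) =
      LaurentPolynomial.C (n : ℂ) := by
    ext m
    rw [AddMonoidAlgebra.coeff_mapRingHom, LaurentPolynomial.C_apply, LaurentPolynomial.C_apply]
    split_ifs <;> simp
  have hT (n : ℤ) : AddMonoidAlgebra.mapRingHom ℤ (Int.castRingHom ℂ) (LaurentPolynomial.T n) =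
      LaurentPolynomial.T n := by
    ext m
    rw [AddMonoidAlgebra.coeff_mapRingHom, LaurentPolynomial.T_apply, LaurentPolynomial.T_apply]
    split_ifs <;> simp
  simp only [palindromicLaurent, cosinePolynomial, map_add, map_sum, map_mul, hC, hT,
    LaurentPolynomial.eval₂_C, LaurentPolynomial.eval₂_T, RingHom.id_apply,
    Units.val_zpow_eq_zpow_val]
  push_cast
  congr 1
  refine Finset.sum_congr rfl fun i _ => ?_
  rw [Complex.two_cos, hu, ← Complex.exp_int_mul, ← Complex.exp_int_mul]
  push_cast
  congr 3 <;> ring_nf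

theorem cosinePolynomial_nonneg_or_nonpos {d : ℕ} {a : ℕ → ℤ}
    (h : ¬ HasOddOrderZeroOnUnitCircle (palindromicLaurent d a)) :
    (∀ θ, 0 ≤ cosinePolynomial d a θ) ∨ ∀ θ, cosinePolynomial d a θ ≤ 0 := by
  obtain ⟨n, p, hp⟩ := LaurentPolynomial.exists_T_pow
    (AddMonoidAlgebra.mapRingHom ℤ (Int.castRingHom ℂ) (palindromicLaurent d a))
  refine nonneg_or_nonpos_of_even_rootMultiplicity p ?_ (-n) 1 _ fun θ => ?_
  · intro z hz
    by_contra hodd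
    rw [Nat.not_even_iff_odd] at hodd
    refine h ⟨z, hz, _, hodd, hasZeroOfOrder_rootMultiplicity ?_ hp ?_⟩
    -- The zero polynomial has root multiplicity `0` by convention, which is not odd.
    · rintro rfl; simp at hodd
    · rintro rfl; simp at hz
  · obtain ⟨u, hu⟩ := (Complex.exp_ne_zero (θ * Complex.I)).isUnit
    have h1 := congrArg (LaurentPolynomial.eval₂ (RingHom.id ℂ) u) hp
    rw [LaurentPolynomial.eval₂_toLaurent, map_mul,
      eval₂_mapRingHom_palindromicLaurent d a u θ hu, LaurentPolynomial.eval₂_T_n,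
      Polynomial.eval₂_id, hu] at h1
    rw [h1, zpow_neg, zpow_natCast]
    have := pow_ne_zero n (Complex.exp_ne_zero (θ * Complex.I))
    field_simp

/-! ### Quadrature and the Egerváry–Szász inequality -/

/-- Equidistributed nodes integrate `cos (l θ)` exactly unless `l` is a multiple of their number. -/
theorem sum_cos_nodes_eq_zero {M : ℕ} (hM : M ≠ 0) {l : ℤ} (hl : ¬ (M : ℤ) ∣ l) (φ : ℝ) :
    ∑ k ∈ Finset.range M, Real.cos (l * (φ + 2 * Real.pi * k / M)) = 0 := by
  have hζ := Complex.isPrimitiveRoot_exp M hM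
  set ζ := Complex.exp (2 * Real.pi * Complex.I / M) with hζdef
  have h1 : ζ ^ l ≠ 1 := fun h => hl ((hζ.zpow_eq_one_iff_dvd l).1 h)
  have h2 : ∑ k ∈ Finset.range M, (ζ ^ l) ^ k = 0 := by
    have h3 := geom_sum_mul (ζ ^ l) M
    rw [← zpow_natCast, zpow_comm, zpow_natCast, hζ.pow_eq_one, one_zpow, sub_self] at h3
    exact (mul_eq_zero.1 h3).resolve_right (sub_ne_zero.2 h1)
  have h4 (k : ℕ) : Real.cos (l * (φ + 2 * Real.pi * k / M)) =
      (Complex.exp (l * φ * Complex.I) * (ζ ^ l) ^ k).re := by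
    rw [hζdef, ← Complex.exp_int_mul, ← Complex.exp_nat_mul, ← Complex.exp_add,
      ← Complex.exp_ofReal_mul_I_re]
    congr 2
    push_cast
    ring
  simp_rw [h4]
  rw [← Complex.re_sum, ← Finset.mul_sum, h2, mul_zero, Complex.zero_re]

theorem sum_cosinePolynomial_nodes {d M : ℕ} (a : ℕ → ℤ) (hM : d < M) (φ : ℝ) :
    ∑ k ∈ Finset.range M, cosinePolynomial d a (φ + 2 * Real.pi * k / M) = M * a 0 := by
  simp only [cosinePolynomial, Finset.sum_add_distrib]
  rw [Finset.sum_comm, Finset.sum_eq_zero (s := Finset.Icc 1 d), add_zero]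
  · simp
  · intro i hi
    rw [Finset.mem_Icc] at hi
    have hnd : ¬ (M : ℤ) ∣ (i : ℤ) := by
      rw [Int.natCast_dvd_natCast]
      exact Nat.not_dvd_of_pos_of_lt (by omega) (by omega)
    have h := sum_cos_nodes_eq_zero (by omega) hnd φ
    rw [← Finset.mul_sum, ← Finset.mul_sum]
    push_cast at h
    rw [h]
    simp

/-- The product has frequencies `j` and `i ± j`, all smaller than `M` in absolute value, so only the
zero frequency, from `i = j`, survives. -/
theorem sum_cosinePolynomial_mul_cos_nodes {d M j : ℕ} (a : ℕ → ℤ) (hj : j ∈ Finset.Icc 1 d)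
    (hM : d + j < M) (φ : ℝ) :
    ∑ k ∈ Finset.range M, cosinePolynomial d a (φ + 2 * Real.pi * k / M) *
      Real.cos (j * (φ + 2 * Real.pi * k / M)) = M * a j := by
  have hj' := Finset.mem_Icc.1 hj
  have hM0 : M ≠ 0 := by omega
  have hprod (θ : ℝ) : cosinePolynomial d a θ * Real.cos (j * θ) =
      a 0 * Real.cos ((j : ℤ) * θ) + ∑ i ∈ Finset.Icc 1 d,
        a i * (Real.cos (((i : ℤ) + j : ℤ) * θ) + Real.cos (((i : ℤ) - j : ℤ) * θ)) := by
    rw [cosinePolynomial, add_mul, Finset.sum_mul]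
    congr 1
    refine Finset.sum_congr rfl fun i _ => ?_
    push_cast
    rw [add_mul, sub_mul, Real.cos_add, Real.cos_sub]
    ring
  simp only [hprod, Finset.sum_add_distrib]
  rw [Finset.sum_comm, Finset.sum_eq_single_of_mem j hj]
  · simp only [mul_add, ← Finset.mul_sum, Finset.sum_add_distrib]
    simp only [← mul_add]
    rw [sum_cos_nodes_eq_zero hM0, sum_cos_nodes_eq_zero hM0]
    · simp [mul_comm]
    · intro h
      have := Int.le_of_dvd (by omega) h
      omega
    · intro h
      have := Int.le_of_dvd (by omega) h
      omega
  · intro i hi hij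
    rw [Finset.mem_Icc] at hi
    rw [← Finset.mul_sum, Finset.sum_add_distrib, sum_cos_nodes_eq_zero hM0,
      sum_cos_nodes_eq_zero hM0]
    · simp
    · intro h
      have := Int.eq_zero_of_abs_lt_dvd h (by rw [abs_lt]; omega)
      omega
    · intro h
      have := Int.le_of_dvd (by omega) h
      omega

/-- An odd multiple of `π / N` stays at distance at least `π / N` from every multiple of `2π`;
reduce `k` modulo `N` to see this. -/
theorem cos_odd_mul_pi_div_le {N : ℕ} (hN : 0 < N) (k : ℕ) :
    Real.cos ((2 * k + 1) * (Real.pi / N)) ≤ Real.cos (Real.pi / N) := by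
  have hN' : (0 : ℝ) < N := by exact_mod_cast hN
  have hpi := Real.pi_pos
  set r := k % N
  have hk : (k : ℝ) = r + N * (k / N : ℕ) := by exact_mod_cast (Nat.mod_add_div k N).symm
  have hr : (r : ℝ) + 1 ≤ N := by exact_mod_cast Nat.mod_lt k hN
  have hr0 : (0 : ℝ) ≤ r := by positivity
  set δ := Real.pi / N with hδ
  have hδ0 : 0 < δ := by positivity
  have hNδ : N * δ = Real.pi := by rw [hδ]; field_simp
  have h1 : Real.cos ((2 * k + 1) * δ) = Real.cos ((2 * r + 1) * δ) := by
    rw [← Real.cos_add_nat_mul_two_pi ((2 * r + 1) * δ) (k / N), hk, ← hNδ]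
    congr 1
    ring
  rw [h1]
  have hlo : δ ≤ (2 * r + 1) * δ := by nlinarith
  have hhi : (2 * r + 1) * δ ≤ 2 * Real.pi - δ := by nlinarith
  rcases le_total ((2 * r + 1) * δ) Real.pi with h | h
  · exact Real.cos_le_cos_of_nonneg_of_le_pi hδ0.le h hlo
  · rw [← Real.cos_two_pi_sub]
    exact Real.cos_le_cos_of_nonneg_of_le_pi hδ0.le (by linarith) (by linarith)

/-- The **Egerváry–Szász inequality**. -/
theorem abs_coeff_le_of_cosinePolynomial_nonneg {d j : ℕ} {a : ℕ → ℤ}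
    (hf : ∀ θ, 0 ≤ cosinePolynomial d a θ) (hj : j ∈ Finset.Icc 1 d) :
    |(a j : ℝ)| ≤ a 0 * Real.cos (Real.pi / ((d / j + 2 : ℕ) : ℝ)) := by
  have hj1 := (Finset.mem_Icc.1 hj).1
  set N := d / j + 2 with hN
  -- The `+ 2` in `N` is what excludes aliasing: `j * (d / j + 1) > d`, and one more `j` covers the
  -- frequency `d + j`.
  have hM : d + j < j * N := by
    have := Nat.lt_mul_div_succ d hj1
    rw [hN]
    linarith
  have hM0 : (0 : ℝ) < (j * N : ℕ) := Nat.cast_pos.2 (Nat.zero_lt_of_lt hM)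
  have hj0 : (j : ℝ) ≠ 0 := by exact_mod_cast (by omega : j ≠ 0)
  have hNpos : 0 < N := Nat.succ_pos _
  have hN0 : (N : ℝ) ≠ 0 := Nat.cast_ne_zero.2 hNpos.ne'
  have key (ε φ : ℝ) (h : ∀ k : ℕ, ε * Real.cos (j * (φ + 2 * Real.pi * k / (j * N : ℕ))) ≤
      Real.cos (Real.pi / N)) : ε * a j ≤ a 0 * Real.cos (Real.pi / N) := by
    refine le_of_mul_le_mul_left ?_ hM0
    calc ((j * N : ℕ) : ℝ) * (ε * a j) = ε * ((j * N : ℕ) * a j) := by ring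
      _ = ∑ k ∈ Finset.range (j * N),
          cosinePolynomial d a (φ + 2 * Real.pi * k / (j * N : ℕ)) *
            (ε * Real.cos (j * (φ + 2 * Real.pi * k / (j * N : ℕ)))) := by
        rw [← sum_cosinePolynomial_mul_cos_nodes a hj hM φ, Finset.mul_sum]
        exact Finset.sum_congr rfl fun k _ => by ring
      _ ≤ ∑ k ∈ Finset.range (j * N),
          cosinePolynomial d a (φ + 2 * Real.pi * k / (j * N : ℕ)) * Real.cos (Real.pi / N) :=
        Finset.sum_le_sum fun k _ => mul_le_mul_of_nonneg_left (h k) (hf _)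
      _ = (j * N : ℕ) * (a 0 * Real.cos (Real.pi / N)) := by
        rw [← Finset.sum_mul, sum_cosinePolynomial_nodes a ((Nat.le_add_right d j).trans_lt hM) φ, mul_assoc]
  have hnode (k : ℕ) : (j : ℝ) * (Real.pi / (j * N) + 2 * Real.pi * k / (j * N : ℕ)) =
      (2 * k + 1) * (Real.pi / N) := by
    push_cast
    field_simp
    ring
  have hle (k : ℕ) := cos_odd_mul_pi_div_le hNpos k
  rw [abs_le']
  constructor
  · have := key 1 (Real.pi / (j * N)) fun k => by rw [one_mul, hnode]; exact hle k
    linarith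
  -- Shifting the nodes by `π / j` flips the sign of `cos (j θ)`, which bounds `-a j`.
  · have := key (-1) (Real.pi / (j * N) + Real.pi / j) fun k => by
      rw [add_right_comm, mul_add, hnode, mul_div_cancel₀ _ hj0, Real.cos_add_pi]
      linarith [hle k]
    linarith

theorem cosinePolynomial_neg (d : ℕ) (a : ℕ → ℤ) (θ : ℝ) :
    cosinePolynomial d (-a) θ = -cosinePolynomial d a θ := by
  simp [cosinePolynomial, Finset.sum_neg_distrib, add_comm]

/-! ### Niven's theorem excludes equality -/

/-- The value of `cos (π / N)` is never a fraction with odd denominator when `N ≥ 3`. -/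
theorem abs_ne_abs_mul_cos_pi_div {N : ℕ} (hN : 3 ≤ N) {b c : ℤ} (hb : Odd b) :
    |(c : ℝ)| ≠ |(b : ℝ)| * Real.cos (Real.pi / N) := by
  intro h
  have hpi := Real.pi_pos
  have hN' : (3 : ℝ) ≤ N := by exact_mod_cast hN
  have hb0 : (b : ℝ) ≠ 0 := by
    rintro h0
    rw [Int.cast_eq_zero.1 h0] at hb
    simp at hb
  have hδ0 : 0 < Real.pi / N := by positivity
  have hδ : Real.pi / N < Real.pi / 2 := div_lt_div_of_pos_left hpi (by norm_num) (by linarith)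
  have hpos : 0 < Real.cos (Real.pi / N) := Real.cos_pos_of_mem_Ioo ⟨by linarith, hδ⟩
  have hlt : Real.cos (Real.pi / N) < 1 := by
    rw [← Real.cos_zero]
    exact Real.cos_lt_cos_of_nonneg_of_le_pi le_rfl (by linarith) hδ0
  have hq : Real.cos (Real.pi / N) = |(c : ℝ)| / |(b : ℝ)| := by
    rw [h]; field_simp
  have hniven := niven (θ := Real.pi / N) ⟨1 / N, by push_cast; ring⟩
    ⟨|(c : ℚ)| / |(b : ℚ)|, by rw [hq]; push_cast; rfl⟩
  simp only [Set.mem_insert_iff, Set.mem_singleton_iff] at hniven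
  have hhalf : Real.cos (Real.pi / N) = 1 / 2 := by
    rcases hniven with h | h | h | h | h <;> linarith
  rw [hhalf] at h
  have h2 : |b| = 2 * |c| := by
    have : |(b : ℝ)| = 2 * |(c : ℝ)| := by linarith
    exact_mod_cast this
  rw [← Int.natAbs_odd] at hb
  rw [Int.abs_eq_natAbs, Int.abs_eq_natAbs] at h2
  obtain ⟨m, hm⟩ := hb
  omega

theorem hasOddOrderZeroOnUnitCircle_palindromicLaurent {d j : ℕ} {a : ℕ → ℤ} (ha : Odd (a 0))
    (hj : j ∈ Finset.Icc 1 d) (hb : CosineBound d a j) :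
    HasOddOrderZeroOnUnitCircle (palindromicLaurent d a) := by
  by_contra hno
  have hj' := Finset.mem_Icc.1 hj
  have hfloor : ((⌊(d : ℝ) / (j : ℝ)⌋ : ℝ) + 2) = ((d / j + 2 : ℕ) : ℝ) := by
    rw [← natCast_floor_eq_intCast_floor (by positivity), Nat.floor_div_eq_div]
    push_cast
    rfl
  unfold CosineBound at hb
  rw [hfloor] at hb
  -- Here `j ≤ d` matters: `N = 2` would allow equality with `a j = 0`.
  have hN : 3 ≤ d / j + 2 := by
    have := Nat.div_pos hj'.2 hj'.1
    omega
  have hcos : 0 ≤ Real.cos (Real.pi / ((d / j + 2 : ℕ) : ℝ)) := by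
    have h3 : (2 : ℝ) ≤ ((d / j + 2 : ℕ) : ℝ) := by exact_mod_cast (by omega : 2 ≤ d / j + 2)
    have hpi := Real.pi_pos
    have : 0 ≤ Real.pi / ((d / j + 2 : ℕ) : ℝ) := by positivity
    exact Real.cos_nonneg_of_mem_Icc ⟨by linarith, div_le_div_of_nonneg_left hpi.le (by norm_num) h3⟩
  have hle : |(a j : ℝ)| ≤ |(a 0 : ℝ)| * Real.cos (Real.pi / ((d / j + 2 : ℕ) : ℝ)) := by
    rcases cosinePolynomial_nonneg_or_nonpos hno with h | h
    · exact (abs_coeff_le_of_cosinePolynomial_nonneg h hj).trans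
        (mul_le_mul_of_nonneg_right (le_abs_self _) hcos)
    · have h' (θ) : 0 ≤ cosinePolynomial d (-a) θ := by
        rw [cosinePolynomial_neg]
        linarith [h θ]
      have h2 := abs_coeff_le_of_cosinePolynomial_nonneg h' hj
      simp only [Pi.neg_apply, Int.cast_neg, abs_neg] at h2
      exact h2.trans (mul_le_mul_of_nonneg_right (neg_le_abs _) hcos)
  exact abs_ne_abs_mul_cos_pi_div hN ha (le_antisymm hle hb)

theorem odd_of_eval₂_one_palindromicLaurent {d : ℕ} {a : ℕ → ℤ}
    (h : LaurentPolynomial.eval₂ (RingHom.id ℤ) 1 (palindromicLaurent d a) = 1) : Odd (a 0) := by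
  simp only [palindromicLaurent, map_add, map_sum, map_mul, LaurentPolynomial.eval₂_C,
    LaurentPolynomial.eval₂_T, RingHom.id_apply, one_zpow, Units.val_one] at h
  rw [← Finset.sum_mul] at h
  exact ⟨-∑ i ∈ Finset.Icc 1 d, a i, by linarith⟩

theorem theorem1p3 :
    -- integral palindromic Laurent polynomials with odd constant coefficient
    (∀ (d : ℕ) (a : ℕ → ℤ), Odd (a 0) →
      (∃ j ∈ Finset.Icc 1 d, CosineBound d a j) →
      HasOddOrderZeroOnUnitCircle (palindromicLaurent d a)) ∧
    -- Alexander polynomials of knots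
    (∀ (K : Set ThreeSphere), IsTameKnot K →
      ∀ D : ℤ[T;T⁻¹], IsConwayAlexanderPolynomial K D →
      ∀ (d : ℕ) (a : ℕ → ℤ), D = palindromicLaurent d a →
      (∃ j ∈ Finset.Icc 1 d, CosineBound d a j) →
      HasOddOrderZeroOnUnitCircle D) := by
  refine ⟨fun d a ha ⟨j, hj, hb⟩ => hasOddOrderZeroOnUnitCircle_palindromicLaurent ha hj hb, ?_⟩
  rintro K - D ⟨-, -, hD⟩ d a rfl ⟨j, hj, hb⟩
  exact hasOddOrderZeroOnUnitCircle_palindromicLaurent (odd_of_eval₂_one_palindromicLaurent hD) hj hb
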